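/- For $v=(v_0,v_1,v_2)\in(\mathbb{Q}^\times)^3$, $w=(w_1,w_2)\in\mathbb{Z}^2$ and $M=\begin{pmatrix}a&b\\c&d\end{pmatrix}\in\operatorname{GL}_2(\mathbb{Z})$, and for a Laurent polynomial $P\in\mathbb{Q}[x^{\pm1},y^{\pm1}]$, put $$v\ast P:=v_0\,P(v_1x,v_2y),\qquad w\ast P:=x^{w_1}y^{w_2}P,\qquad M\ast P:=P(x^ay^b,x^cy^d),$$ and $P_\alpha:=v\ast(w\ast(M\ast P))$ for $\alpha=(v,w,M)$. For a nonzero $P$ let $V_P(\mathbb{C})=\{(x,y)\in(\mathbb{C}^\times)^2: P(x,y)=0\}$, let $V_P^{\mathrm{sing}}(\mathbb{C})$ be the set of singular points of the zero locus $V_P$ (with its reduced structure), let $\gamma_P:=\{(x,y)\in V_P(\mathbb{C}): |x|=1,\ |y|\le 1\}$ be Deninger's path, and let $\mathbb{T}^2=\{(x,y)\in(\mathbb{C}^\times)^2: |x|=|y|=1\}$. Let $Q\in\mathbb{Q}[x^{\pm1},y^{\pm1}]$ be a nonzero Laurent polynomial. Then there exists $\alpha\in(\mathbb{Q}^\times)^3\times\mathbb{Z}^2\times\operatorname{GL}_2(\mathbb{Z})$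 such that $$Q_\alpha\in 1+y\,\mathbb{Z}[x,y],\qquad V_{Q_\alpha}(\mathbb{C})\cap\mathbb{T}^2=\emptyset,\qquad \gamma_{Q_\alpha}\cap V_{Q_\alpha}^{\mathrm{sing}}(\mathbb{C})=\emptyset .$$ -/

import Mathlib

noncomputable section

/-- The ring `R[x₁^{±1}, …, xₙ^{±1}]` of Laurent polynomials in `n` variables. -/
abbrev LaurentPoly (R : Type*) [CommRing R] (n : ℕ) : Type _ :=
  AddMonoidAlgebra R (Fin n → ℤ)

namespace LaurentPoly

/-- The monomial `x^z = x₁^{z₁} ⋯ xₙ^{zₙ}`, as a unit of the Laurent polynomial ring. -/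
def mono (R : Type*) [CommRing R] {n : ℕ} (z : Fin n → ℤ) : (LaurentPoly R n)ˣ where
  val := AddMonoidAlgebra.single z 1
  inv := AddMonoidAlgebra.single (-z) 1
  val_inv := by
    rw [AddMonoidAlgebra.single_mul_single, add_neg_cancel, one_mul, AddMonoidAlgebra.one_def]
  inv_val := by
    rw [AddMonoidAlgebra.single_mul_single, neg_add_cancel, one_mul, AddMonoidAlgebra.one_def]

/-- The variable `xᵢ`. -/
def X (R : Type*) [CommRing R] {n : ℕ} (i : Fin n) : (LaurentPoly R n)ˣ :=
  mono R (Pi.single i 1)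

/-- The value `P(u₁, …, uₙ)` of a Laurent polynomial at units `u₁, …, uₙ` of an `R`-algebra. -/
def subst {R A : Type*} [CommRing R] [CommRing A] [Algebra R A] {n : ℕ} (u : Fin n → Aˣ) :
    LaurentPoly R n →ₐ[R] A :=
  AddMonoidAlgebra.lift R A (Fin n → ℤ)
    { toFun := fun z => ((∏ i, u i ^ (Multiplicative.toAdd z i) : Aˣ) : A)
      map_one' := by simp
      map_mul' := fun z w => by
        rw [← Units.val_mul, ← Finset.prod_mul_distrib]
        simp [zpow_add] }

/-- The formal partial derivative `∂P/∂xᵢ`: it sends `c x^z` to `zᵢ c x^{z - eᵢ}`. -/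
def pderiv {R : Type*} [CommRing R] {n : ℕ} (i : Fin n) (P : LaurentPoly R n) :
    LaurentPoly R n :=
  P.coeff.sum fun z c => AddMonoidAlgebra.single (z - Pi.single i 1) ((z i : R) * c)

/-- The parameters `(v, w, M) ∈ (Rˣ)^{n+1} × (ℤⁿ ⋊ GLₙ(ℤ))` of a transformation of Laurent
polynomials. -/
structure Transformation (R : Type*) [CommRing R] (n : ℕ) where
  /-- The scaling factors `(v₀, v₁, …, vₙ)`. -/
  v : Fin (n + 1) → Rˣ
  /-- The exponent of the monomial factor. -/
  w : Fin n → ℤ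
  /-- The monomial change of variables. -/
  M : Matrix.GeneralLinearGroup (Fin n) ℤ

/-- `v ∗ P = v₀ P(v₁ x₁, …, vₙ xₙ)`. -/
def scale {R : Type*} [CommRing R] {n : ℕ} (v : Fin (n + 1) → Rˣ) (P : LaurentPoly R n) :
    LaurentPoly R n :=
  (v 0 : R) • subst (fun i => Units.map (algebraMap R (LaurentPoly R n)) (v i.succ) * X R i) P

/-- `w ∗ P = x^w P`. -/
def shift {R : Type*} [CommRing R] {n : ℕ} (w : Fin n → ℤ) (P : LaurentPoly R n) :
    LaurentPoly R n :=
  (mono R w : LaurentPoly R n) * P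

/-- `M ∗ P = P(x^{m₁}, …, x^{mₙ})`, where `m₁, …, mₙ` are the rows of `M`. -/
def changeVars {R : Type*} [CommRing R] {n : ℕ} (M : Matrix.GeneralLinearGroup (Fin n) ℤ)
    (P : LaurentPoly R n) : LaurentPoly R n :=
  subst (fun i => mono R ((M : Matrix (Fin n) (Fin n) ℤ) i)) P

/-- The transformed polynomial `P_α = v ∗ (w ∗ (M ∗ P))` for `α = (v, w, M)`. -/
def Transformation.act {R : Type*} [CommRing R] {n : ℕ} (α : Transformation R n)
    (P : LaurentPoly R n) : LaurentPoly R n :=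
  scale α.v (shift α.w (changeVars α.M P))

/-- The complex points `V_P(ℂ)` of the zero locus of `P` inside `𝔾ₘⁿ`. -/
def zeroLocus {R : Type*} [CommRing R] [Algebra R ℂ] {n : ℕ} (P : LaurentPoly R n) :
    Set (Fin n → ℂˣ) :=
  {u | subst u P = 0}

/-- The singular complex points of the zero locus `V_P ⊆ 𝔾ₘⁿ` of a nonzero Laurent polynomial
`P`, by the Jacobian criterion. The variety `V_P` is empty or of pure codimension one, so a point
of it is regular exactly when some Laurent polynomial that vanishes identically on `V_P(ℂ)` has a
nonzero gradient there. The whole vanishing ideal is used, so that `V_P` is the zero locus with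
its reduced structure and repeated factors of `P` do not matter. -/
def singularLocus {R : Type*} [CommRing R] [Algebra R ℂ] {n : ℕ} (P : LaurentPoly R n) :
    Set (Fin n → ℂˣ) :=
  {u | u ∈ zeroLocus P ∧
    ∀ F : LaurentPoly ℂ n, (∀ t ∈ zeroLocus P, subst t F = 0) →
      ∀ i, subst u (pderiv i F) = 0}

/-- The real unit torus `𝕋ⁿ ⊆ 𝔾ₘⁿ(ℂ)`. -/
def unitTorus (n : ℕ) : Set (Fin n → ℂˣ) :=
  {u | ∀ i, ‖(u i : ℂ)‖ = 1}

/-- Deninger's path `γ_P = {(x, y) ∈ V_P(ℂ) : |x| = 1, |y| ≤ 1}`. -/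
def deningerPath {R : Type*} [CommRing R] [Algebra R ℂ] (P : LaurentPoly R 2) :
    Set (Fin 2 → ℂˣ) :=
  {u | u ∈ zeroLocus P ∧ ‖(u 0 : ℂ)‖ = 1 ∧ ‖(u 1 : ℂ)‖ ≤ 1}

/-- The set `1 + y ℤ[x, y]` inside `ℚ[x^{±1}, y^{±1}]`. -/
def onePlusYIntPoly : Set (LaurentPoly ℚ 2) :=
  {P | ∃ F : MvPolynomial (Fin 2) ℤ,
    P = 1 + (X ℚ (1 : Fin 2) : LaurentPoly ℚ 2) *
      MvPolynomial.aeval (fun i => (X ℚ i : LaurentPoly ℚ 2)) F}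

end LaurentPoly

end

/-! A unimodular change of exponents and a monomial factor bring `Q` to the shape `c (1 + y H)`;
everything else is achieved by rescaling `x` and `y` by integers. View `P = 1 + y H` as a polynomial
in `y` over `ℂ[x]`. All but finitely many circles `|x| = n` avoid the zeros of its leading
coefficient, so by compactness the roots `y` above such a circle are bounded. Replacing `x` by `n x`
and `y` by a large multiple of itself then pushes every zero with `|x| = 1` into `|y| < 1`, off the
torus. Taking that multiple divisible by a denominator `D` of `H` also makes the coefficients
integral.

For regularity, the radical of `P` in `ℂ(x)[y]` is separable, hence coprime to its `y`-derivative.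
Clearing denominators gives `F` vanishing on the curve, with `∂F/∂y ≠ 0` at its points outside
finitely many lines `r(x) = 0`; the circle `|x| = n` is chosen to miss these too. -/

/-! ### Bivariate polynomials: separability and bounds on roots. -/

open Polynomial in
/-- A nonzero bivariate polynomial `P` has a companion `F` that vanishes on the zero set of `P`
and whose `Y`-derivative does not vanish at any zero of `P` outside finitely many vertical
lines. -/
theorem Polynomial.exists_vanishing_derivative_ne_zero {k : Type*} [Field k] [CharZero k]
    (P : k[X][X]) (hP : P ≠ 0) :
    ∃ (F : k[X][X]) (r : k[X]), r ≠ 0 ∧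
      (∀ x y, P.evalEval x y = 0 → F.evalEval x y = 0) ∧
      ∀ x y, r.eval x ≠ 0 → P.evalEval x y = 0 → (derivative F).evalEval x y ≠ 0 := by
  classical
  let K := FractionRing k[X]
  let φ : k[X] →+* K := algebraMap k[X] K
  have hφ : Function.Injective φ := IsFractionRing.injective k[X] K
  have hφ' : Function.Injective (Polynomial.map φ) := Polynomial.map_injective φ hφ
  have clear : ∀ q : K[X], ∃ d : k[X], d ≠ 0 ∧ ∃ Q : k[X][X], Q.map φ = C (φ d) * q := by
    intro q
    obtain ⟨b, hb, h⟩ := IsLocalization.integerNormalization_spec (nonZeroDivisors k[X]) q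
    refine ⟨b, nonZeroDivisors.ne_zero hb, _, h.trans ?_⟩
    rw [← algebraMap_smul K b q, smul_eq_C_mul]
  have : CharZero K := charZero_of_injective_algebraMap
    ((IsFractionRing.injective k[X] K).comp (algebraMap k k[X]).injective :
      Function.Injective ((algebraMap k[X] K).comp (algebraMap k k[X])).toAlgebra.algebraMap)
  let p : K[X] := P.map φ
  have hp : p ≠ 0 := fun h => hP (hφ' (by rw [Polynomial.map_zero]; exact h))
  let s : K[X] := UniqueFactorizationMonoid.radical p
  have hs : s.Separable :=
    PerfectField.separable_iff_squarefree.2 UniqueFactorizationMonoid.squarefree_radical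
  obtain ⟨n, t, ht⟩ := UniqueFactorizationMonoid.exists_dvd_radical_self_pow hp
  change s ^ n = p * t at ht
  obtain ⟨a₁, a₂, ha⟩ := hs
  obtain ⟨b, hb, S, hS⟩ := clear s
  obtain ⟨e, he, T, hT⟩ := clear t
  obtain ⟨d₁, hd₁, A₁, hA₁⟩ := clear a₁
  obtain ⟨d₂, hd₂, A₂, hA₂⟩ := clear a₂
  have hpow : C e * S ^ n = C (b ^ n) * P * T := by
    apply hφ'
    simp only [Polynomial.map_mul, Polynomial.map_pow, map_C, hS, hT, map_pow]
    change _ = C (φ b) ^ n * p * _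
    rw [mul_pow, ht]
    ring
  -- The right side depends on `x` alone, so `S` and its derivative share no zero where it is
  -- nonzero.
  have hbez : C d₂ * A₁ * S + C d₁ * A₂ * derivative S = C (b * d₁ * d₂) := by
    apply hφ'
    have hS' : (derivative S).map φ = C (φ b) * derivative s := by
      rw [← derivative_map, hS, derivative_C_mul]
    simp only [Polynomial.map_add, Polynomial.map_mul, map_C, hS, hS', hA₁, hA₂, map_mul]
    linear_combination C (φ b) * C (φ d₁) * C (φ d₂) * ha
  have hev : ∀ x y, P.evalEval x y = 0 → e.eval x * S.evalEval x y ^ n = 0 := by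
    intro x y h
    have := congrArg (evalEval x y) hpow
    simpa [evalEval_mul, evalEval_pow, evalEval_C, h] using this
  -- On the lines `e(x) = 0`, `S` need not vanish at zeros of `P`; the factor `e` forces vanishing
  -- there.
  refine ⟨C e * S, e * (b * d₁ * d₂), by positivity, ?_, ?_⟩
  · intro x y h
    rw [evalEval_mul, evalEval_C]
    rcases mul_eq_zero.1 (hev x y h) with h | h
    · rw [h, zero_mul]
    · rw [eq_zero_of_pow_eq_zero h, mul_zero]
  · intro x y hr h
    rw [eval_mul, mul_ne_zero_iff] at hr
    have hS0 : S.evalEval x y = 0 :=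
      eq_zero_of_pow_eq_zero ((mul_eq_zero.1 (hev x y h)).resolve_left hr.1)
    have hz := congrArg (evalEval x y) hbez
    rw [evalEval_add, evalEval_mul, hS0, mul_zero, zero_add, evalEval_mul, evalEval_C] at hz
    rw [derivative_C_mul, evalEval_mul, evalEval_C]
    refine mul_ne_zero hr.1 fun h0 => hr.2 ?_
    rw [← hz, h0, mul_zero]

open Polynomial in
/-- If the leading coefficient of `P(X, Y)` in `Y` has no zero on the circle `‖x‖ = R`, then the
zeros of `P` above this circle are bounded. -/
theorem Polynomial.exists_bound_evalEval_ne_zero (P : ℂ[X][X]) (R : ℝ)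
    (hR : ∀ x : ℂ, ‖x‖ = R → P.leadingCoeff.eval x ≠ 0) :
    ∃ T : ℝ, ∀ x y : ℂ, ‖x‖ = R → T ≤ ‖y‖ → P.evalEval x y ≠ 0 := by
  have hcpt : IsCompact (Metric.sphere (0 : ℂ) R) := isCompact_sphere 0 R
  -- This is the Cauchy bound of `P(x, ·)`: on the circle the degree in `y` stays constant, so one
  -- continuous formula serves for all `x`.
  have hcont : ContinuousOn (fun x : ℂ => ((Finset.range P.natDegree).sup
      fun i => ‖(P.coeff i).eval x‖₊) / ‖P.leadingCoeff.eval x‖₊ + 1) (Metric.sphere 0 R) := by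
    refine (ContinuousOn.div ?_ ?_ ?_).add continuousOn_const
    · exact (Continuous.finset_sup_apply fun i _ => (P.coeff i).continuous.nnnorm).continuousOn
    · exact P.leadingCoeff.continuous.nnnorm.continuousOn
    · exact fun x hx => nnnorm_ne_zero_iff.2 (hR x (by simpa using hx))
  obtain ⟨T, hT⟩ := (hcpt.image_of_continuousOn hcont).bddAbove
  refine ⟨T, fun x y hx hy h => ?_⟩
  have hlc := hR x hx
  have hlc' : (evalRingHom x) P.leadingCoeff ≠ 0 := hlc
  have hdeg : (P.map (evalRingHom x)).natDegree = P.natDegree :=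
    natDegree_map_of_leadingCoeff_ne_zero _ hlc'
  have hne : P.map (evalRingHom x) ≠ 0 := by
    intro h0
    apply hlc'
    rw [leadingCoeff, ← coeff_map, h0, coeff_zero]
  have hroot : (P.map (evalRingHom x)).IsRoot y := by
    rw [IsRoot, map_evalRingHom_eval, h]
  have hlt := hroot.norm_lt_cauchyBound hne
  have hle : (P.map (evalRingHom x)).cauchyBound ≤ T := by
    refine hT ⟨x, by simpa using hx, ?_⟩
    simp only [cauchyBound, hdeg, leadingCoeff, coeff_map, coe_evalRingHom]
  have : ‖y‖₊ < T := hlt.trans_le hle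
  exact absurd hy (not_le.2 (by exact_mod_cast this))

-- Any `n` beyond the Cauchy bound works; an integer radius keeps the substitution `x ↦ n x`
-- integral.
open Polynomial in
theorem Polynomial.exists_nat_eval_ne_zero_of_norm_eq (g : ℂ[X]) (hg : g ≠ 0) :
    ∃ n : ℕ, n ≠ 0 ∧ ∀ x : ℂ, ‖x‖ = n → g.eval x ≠ 0 := by
  obtain ⟨n, hn⟩ := exists_nat_gt (g.cauchyBound : ℝ)
  refine ⟨n, ?_, fun x hx h => ?_⟩
  · rintro rfl
    exact absurd hn (not_lt.2 (by rw [Nat.cast_zero]; exact NNReal.coe_nonneg _))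
  · have := IsRoot.norm_lt_cauchyBound hg h
    have h' : ‖x‖ < g.cauchyBound := by exact_mod_cast this
    linarith

theorem MvPolynomial.exists_int_multiple {σ : Type*} (H : MvPolynomial σ ℚ) :
    ∃ (D : ℤ) (G : MvPolynomial σ ℤ), D ≠ 0 ∧
      MvPolynomial.map (Int.castRingHom ℚ) G = MvPolynomial.C (D : ℚ) * H := by
  induction H using MvPolynomial.induction_on with
  | C a =>
    refine ⟨a.den, MvPolynomial.C a.num, by exact_mod_cast a.den_nz, ?_⟩
    rw [MvPolynomial.map_C, ← MvPolynomial.C_mul]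
    congr 1
    simp
  | add p q hp hq =>
    obtain ⟨D, G, hD, h⟩ := hp
    obtain ⟨D', G', hD', h'⟩ := hq
    refine ⟨D * D', MvPolynomial.C D' * G + MvPolynomial.C D * G', mul_ne_zero hD hD', ?_⟩
    rw [map_add, map_mul, map_mul, MvPolynomial.map_C, MvPolynomial.map_C, h, h', eq_intCast,
      eq_intCast, Int.cast_mul, map_mul]
    ring
  | mul_X p i hp =>
    obtain ⟨D, G, hD, h⟩ := hp
    refine ⟨D, G * MvPolynomial.X i, hD, ?_⟩
    rw [map_mul, h, MvPolynomial.map_X, mul_assoc]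

/-! ### Laurent monomials, derivatives and the normal form `c (1 + y H)`. -/

namespace LaurentPoly

theorem subst_single {R A : Type*} [CommRing R] [CommRing A] [Algebra R A] {n : ℕ}
    (u : Fin n → Aˣ) (z : Fin n → ℤ) (c : R) :
    subst u (AddMonoidAlgebra.single z c : LaurentPoly R n) = c • ((∏ i, u i ^ z i : Aˣ) : A) := by
  simp [subst]

theorem mono_eq_single {R : Type*} [CommRing R] {n : ℕ} (z : Fin n → ℤ) :
    (mono R z : LaurentPoly R n) = AddMonoidAlgebra.single z 1 := rfl

theorem mono_add {R : Type*} [CommRing R] {n : ℕ} (z w : Fin n → ℤ) :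
    mono R (z + w) = mono R z * mono R w := by
  ext1
  simp [mono_eq_single, AddMonoidAlgebra.single_mul_single]

theorem mono_zsmul {R : Type*} [CommRing R] {n : ℕ} (z : Fin n → ℤ) (k : ℤ) :
    mono R (k • z) = mono R z ^ k := by
  let f : Multiplicative (Fin n → ℤ) →* (LaurentPoly R n)ˣ :=
    MonoidHom.mk' (fun z => mono R z.toAdd) fun a b => mono_add _ _
  exact map_zpow f (Multiplicative.ofAdd z) k

theorem prod_mono_zpow {R : Type*} [CommRing R] {n : ℕ} (M : Matrix (Fin n) (Fin n) ℤ)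
    (z : Fin n → ℤ) : ∏ i, mono R (M i) ^ z i = mono R (Matrix.vecMul z M) := by
  let f : Multiplicative (Fin n → ℤ) →* (LaurentPoly R n)ˣ :=
    MonoidHom.mk' (fun z => mono R z.toAdd) fun a b => mono_add _ _
  rw [Matrix.vecMul_eq_sum]
  refine (Finset.prod_congr rfl fun i _ => (mono_zsmul (M i) (z i)).symm).trans ?_
  exact (map_prod f (fun i => Multiplicative.ofAdd (z i • M i)) Finset.univ).symm

theorem shift_changeVars_single {R : Type*} [CommRing R] {n : ℕ} (w : Fin n → ℤ)
    (M : Matrix.GeneralLinearGroup (Fin n) ℤ) (z : Fin n → ℤ) (c : R) :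
    shift w (changeVars M (AddMonoidAlgebra.single z c)) =
      AddMonoidAlgebra.single (w + Matrix.vecMul z (M : Matrix (Fin n) (Fin n) ℤ)) c := by
  rw [shift, changeVars, subst_single, prod_mono_zpow, mono_eq_single, mono_eq_single]
  simp [AddMonoidAlgebra.single_mul_single]

theorem pderiv_add {R : Type*} [CommRing R] {n : ℕ} (i : Fin n) (P Q : LaurentPoly R n) :
    pderiv i (P + Q) = pderiv i P + pderiv i Q := by
  simp only [pderiv, AddMonoidAlgebra.coeff_add]
  refine Finsupp.sum_add_index' ?_ ?_
  · simp
  · intro z a b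
    rw [mul_add, AddMonoidAlgebra.single_add]

theorem pderiv_single {R : Type*} [CommRing R] {n : ℕ} (i : Fin n) (z : Fin n → ℤ) (c : R) :
    pderiv i (AddMonoidAlgebra.single z c : LaurentPoly R n) =
      AddMonoidAlgebra.single (z - Pi.single i 1) ((z i : R) * c) := by
  rw [pderiv, AddMonoidAlgebra.coeff_single]
  exact Finsupp.sum_single_index (by simp)

open Polynomial in
/-- Every bivariate polynomial `F(ax, by)` with rescaled variables is represented by a Laurent
polynomial, compatibly with the derivative in the second variable. -/
theorem exists_subst_eq_evalEval (a b : ℂ) (F : ℂ[X][X]) :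
    ∃ L : LaurentPoly ℂ 2, ∀ u : Fin 2 → ℂˣ,
      subst u L = F.evalEval (a * u 0) (b * u 1) ∧
      subst u (pderiv 1 L) = b * (derivative F).evalEval (a * u 0) (b * u 1) := by
  induction F using Polynomial.induction_on' with
  | add p q hp hq =>
    obtain ⟨L, hL⟩ := hp
    obtain ⟨L', hL'⟩ := hq
    refine ⟨L + L', fun u => ⟨?_, ?_⟩⟩
    · rw [map_add, (hL u).1, (hL' u).1, evalEval_add]
    · rw [pderiv_add, map_add, (hL u).2, (hL' u).2, derivative_add, evalEval_add, mul_add]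
  | monomial j f =>
    induction f using Polynomial.induction_on' with
    | add p q hp hq =>
      obtain ⟨L, hL⟩ := hp
      obtain ⟨L', hL'⟩ := hq
      refine ⟨L + L', fun u => ⟨?_, ?_⟩⟩
      · rw [map_add, (hL u).1, (hL' u).1, map_add (monomial j), evalEval_add]
      · rw [pderiv_add, map_add, (hL u).2, (hL' u).2, map_add (monomial j), derivative_add,
          evalEval_add, mul_add]
    | monomial i c =>
      refine ⟨AddMonoidAlgebra.single ![(i : ℤ), (j : ℤ)] (c * a ^ i * b ^ j), fun u => ⟨?_, ?_⟩⟩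
      · rw [subst_single]
        simp [evalEval, Fin.prod_univ_two, mul_pow]
        ring
      · rw [pderiv_single, subst_single]
        -- For `j = 0` the formal derivative has `y`-exponent `-1`, but its coefficient is zero.
        cases j with
        | zero => simp [evalEval]
        | succ j =>
          simp [evalEval, Fin.prod_univ_two, mul_pow]
          ring

/-- A monomial substitution and a monomial factor bring every nonzero Laurent polynomial to the
form `c (1 + y H(x, y))` with `H` a polynomial. -/
theorem exists_shift_changeVars_eq (Q : LaurentPoly ℚ 2) (hQ : Q ≠ 0) :
    ∃ (w : Fin 2 → ℤ) (M : Matrix.GeneralLinearGroup (Fin 2) ℤ) (c : ℚ)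
      (H : MvPolynomial (Fin 2) ℚ), c ≠ 0 ∧
      shift w (changeVars M Q) = c • (1 + (X ℚ (1 : Fin 2) : LaurentPoly ℚ 2) *
        MvPolynomial.aeval (fun i => (X ℚ i : LaurentPoly ℚ 2)) H) := by
  classical
  obtain ⟨B, hB⟩ : ∃ B : ℤ, ∀ z ∈ Q.coeff.support, ∀ i, |z i| ≤ B := by
    obtain ⟨B, hB⟩ := (Q.coeff.support.image fun z => ∑ i, |z i|).bddAbove
    refine ⟨B, fun z hz i => le_trans ?_ (hB (Finset.mem_coe.2 (Finset.mem_image_of_mem _ hz)))⟩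
    exact Finset.single_le_sum (f := fun i => |z i|) (fun i _ => abs_nonneg _) (Finset.mem_univ i)
  have hne : Q.coeff.support.Nonempty := by
    rw [Finsupp.support_nonempty_iff]
    intro h
    exact hQ (AddMonoidAlgebra.coeff_injective (by simpa using h))
  obtain ⟨z₀, hz₀, hmin⟩ := Finset.exists_min_image Q.coeff.support
    (fun z => (2 * B + 1) * z 0 + z 1) hne
  -- With `ℓ(z) = (2B+1) z₀ + z₁`, this sends `z` to `(z₀ + 2B ℓ(z), ℓ(z))`. On the box `|zᵢ| ≤ B`
  -- the form `ℓ` is injective, so its minimum on the support is strict. Relative to the minimizer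
  -- every other term has `ℓ`-difference at least 1, and `2B` times it outweighs a first-coordinate
  -- difference of at least `-2B`.
  let A : Matrix (Fin 2) (Fin 2) ℤ := !![1 + 2 * B * (2 * B + 1), 2 * B + 1; 2 * B, 1]
  have hA : A.det = 1 := by
    simp only [A, Matrix.det_fin_two_of]
    ring
  let M : Matrix.GeneralLinearGroup (Fin 2) ℤ := Matrix.GeneralLinearGroup.mk'' A (by simp [hA])
  let w : Fin 2 → ℤ := -Matrix.vecMul z₀ A
  have hother : ∀ z ∈ Q.coeff.support, z ≠ z₀ → ∃ i j : ℕ,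
      w + Matrix.vecMul z A = ![(i : ℤ), (j : ℤ) + 1] := by
    intro z hz hzne
    have b0 := abs_le.1 (hB z hz 0)
    have b1 := abs_le.1 (hB z hz 1)
    have c0 := abs_le.1 (hB z₀ hz₀ 0)
    have c1 := abs_le.1 (hB z₀ hz₀ 1)
    have hle := hmin z hz
    have hlt : (2 * B + 1) * z₀ 0 + z₀ 1 < (2 * B + 1) * z 0 + z 1 := by
      refine lt_of_le_of_ne hle fun heq => hzne ?_
      have h0 : z 0 = z₀ 0 := by
        rcases lt_trichotomy (z 0) (z₀ 0) with h | h | h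
        · nlinarith
        · exact h
        · nlinarith
      have h1 : z 1 = z₀ 1 := by rw [h0] at heq; linarith
      ext i
      fin_cases i
      · exact h0
      · exact h1
    have e0 : (w + Matrix.vecMul z A) 0 =
        (z 0 - z₀ 0) + 2 * B * (((2 * B + 1) * z 0 + z 1) - ((2 * B + 1) * z₀ 0 + z₀ 1)) := by
      simp [w, A, Matrix.vecHead, Matrix.vecTail]
      ring
    have e1 : (w + Matrix.vecMul z A) 1 =
        ((2 * B + 1) * z 0 + z 1) - ((2 * B + 1) * z₀ 0 + z₀ 1) := by
      simp [w, A, Matrix.vecHead, Matrix.vecTail]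
      ring
    obtain ⟨i, hi⟩ := Int.eq_ofNat_of_zero_le (a := (w + Matrix.vecMul z A) 0)
      (by rw [e0]; nlinarith)
    obtain ⟨j, hj⟩ := Int.eq_ofNat_of_zero_le (a := (w + Matrix.vecMul z A) 1 - 1)
      (by rw [e1]; linarith)
    refine ⟨i, j, ?_⟩
    ext k
    fin_cases k
    · exact hi
    · exact eq_add_of_sub_eq hj
  have hsum : ∀ s ⊆ Q.coeff.support.erase z₀, ∃ H : MvPolynomial (Fin 2) ℚ,
      ∑ z ∈ s, AddMonoidAlgebra.single (w + Matrix.vecMul z A) (Q.coeff z) =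
        (X ℚ (1 : Fin 2) : LaurentPoly ℚ 2) *
          MvPolynomial.aeval (fun i => (X ℚ i : LaurentPoly ℚ 2)) H := by
    intro s
    induction s using Finset.induction_on with
    | empty => exact fun _ => ⟨0, by simp⟩
    | insert z s hzs ih =>
      intro hs
      obtain ⟨H, hH⟩ := ih fun a ha => hs (Finset.mem_insert_of_mem ha)
      have hz := Finset.mem_erase.1 (hs (Finset.mem_insert_self z s))
      obtain ⟨i, j, hij⟩ := hother z hz.2 hz.1
      refine ⟨MvPolynomial.C (Q.coeff z) * MvPolynomial.X 0 ^ i * MvPolynomial.X 1 ^ j + H, ?_⟩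
      rw [Finset.sum_insert hzs, hH, hij, map_add, mul_add]
      congr 1
      simp only [map_mul, map_pow, MvPolynomial.aeval_X, MvPolynomial.aeval_C, X, mono_eq_single,
        AddMonoidAlgebra.single_pow, one_pow, ← Algebra.smul_def,
        AddMonoidAlgebra.single_mul_single, AddMonoidAlgebra.smul_single, mul_one,
        one_mul, smul_eq_mul]
      congr 1
      ext k
      fin_cases k
      · simp
      · simp [add_comm]
  obtain ⟨H, hH⟩ := hsum _ subset_rfl
  have hc : Q.coeff z₀ ≠ 0 := Finsupp.mem_support_iff.1 hz₀
  refine ⟨w, M, Q.coeff z₀, MvPolynomial.C (Q.coeff z₀)⁻¹ * H, hc, ?_⟩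
  have hQsum : shift w (changeVars M Q) =
      ∑ z ∈ Q.coeff.support, AddMonoidAlgebra.single (w + Matrix.vecMul z A) (Q.coeff z) := by
    have hlin : shift w (changeVars M Q) =
        ∑ z ∈ Q.coeff.support, shift w (changeVars M (AddMonoidAlgebra.single z (Q.coeff z))) := by
      conv_lhs => rw [← AddMonoidAlgebra.sum_coeff_single Q]
      simp only [shift, changeVars, Finsupp.sum, map_sum, Finset.mul_sum]
    rw [hlin]
    exact Finset.sum_congr rfl fun z _ => shift_changeVars_single w M z _
  rw [hQsum, ← Finset.add_sum_erase _ _ hz₀, hH, smul_add, map_mul, MvPolynomial.aeval_C,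
    ← Algebra.smul_def, mul_smul_comm, smul_smul, mul_inv_cancel₀ hc, one_smul]
  congr 1
  rw [AddMonoidAlgebra.one_def, AddMonoidAlgebra.smul_single, smul_eq_mul, mul_one]
  congr 1
  simp [w]

end LaurentPoly

/-! ### Rescaling and evaluation, then the main theorem. -/

namespace LaurentPoly

theorem subst_X {R A : Type*} [CommRing R] [CommRing A] [Algebra R A] {n : ℕ}
    (u : Fin n → Aˣ) (i : Fin n) : subst u (X R i : LaurentPoly R n) = u i := by
  rw [X, mono_eq_single, subst_single, one_smul, Finset.prod_eq_single i]
  · simp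
  · intro j _ hj
    simp [hj]
  · simp

theorem scale_smul_aeval_X {R : Type*} [CommRing R] {n : ℕ} (v : Fin (n + 1) → Rˣ) (c : R)
    (P : MvPolynomial (Fin n) R) :
    scale v (c • MvPolynomial.aeval (fun i => (X R i : LaurentPoly R n)) P) =
      ((v 0 : R) * c) • MvPolynomial.aeval (fun i => algebraMap R (LaurentPoly R n) (v i.succ) *
        (X R i : LaurentPoly R n)) P := by
  rw [scale, map_smul, smul_smul, MvPolynomial.comp_aeval_apply]
  simp only [subst_X]
  rfl

theorem subst_aeval_algebraMap_mul_X {R A : Type*} [CommRing R] [CommRing A] [Algebra R A]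
    {n : ℕ} (a : Fin n → R) (u : Fin n → Aˣ) (P : MvPolynomial (Fin n) R) :
    subst u (MvPolynomial.aeval (fun i => algebraMap R (LaurentPoly R n) (a i) *
        (X R i : LaurentPoly R n)) P) =
      MvPolynomial.aeval (fun i => algebraMap R A (a i) * (u i : A)) P := by
  rw [MvPolynomial.comp_aeval_apply]
  simp only [map_mul, subst_X, AlgHom.commutes]

end LaurentPoly

open Polynomial in
theorem Polynomial.evalEval_aeval_C_X {R A : Type*} [CommRing R] [CommRing A] [Algebra R A]
    (P : MvPolynomial (Fin 2) R) (x y : A) :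
    (MvPolynomial.aeval ![(C X : A[X][X]), X] P).evalEval x y = MvPolynomial.aeval ![x, y] P := by
  have h := MvPolynomial.comp_aeval_apply (![(C X : A[X][X]), X])
    ((aevalAeval x y : A[X][X] →ₐ[A] A).restrictScalars R) P
  have hf : (fun i => ((aevalAeval x y : A[X][X] →ₐ[A] A).restrictScalars R)
      ((![(C X : A[X][X]), X]) i)) = ![x, y] := by
    ext i
    fin_cases i <;> simp
  rw [hf] at h
  rw [← h, AlgHom.restrictScalars_apply, coe_aevalAeval_eq_evalEval]

open LaurentPoly in
theorem mainTheorem6 (Q : LaurentPoly ℚ 2) (hQ : Q ≠ 0) :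
    ∃ α : LaurentPoly.Transformation ℚ 2,
      α.act Q ∈ LaurentPoly.onePlusYIntPoly ∧
      LaurentPoly.zeroLocus (α.act Q) ∩ LaurentPoly.unitTorus 2 = ∅ ∧
      LaurentPoly.deningerPath (α.act Q) ∩ LaurentPoly.singularLocus (α.act Q) = ∅ := by
  obtain ⟨w, M, c, H, hc, hQH⟩ := exists_shift_changeVars_eq Q hQ
  let P : MvPolynomial (Fin 2) ℚ := 1 + MvPolynomial.X 1 * H
  have hQP : shift w (changeVars M Q) =
      c • MvPolynomial.aeval (fun i => (X ℚ i : LaurentPoly ℚ 2)) P := by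
    rw [hQH, map_add, map_one, map_mul, MvPolynomial.aeval_X]
  let p : Polynomial (Polynomial ℂ) :=
    MvPolynomial.aeval ![Polynomial.C Polynomial.X, Polynomial.X] P
  have hp : ∀ x y, p.evalEval x y = MvPolynomial.aeval ![x, y] P :=
    Polynomial.evalEval_aeval_C_X P
  have hp0 : p ≠ 0 := by
    intro h
    have h0 := hp 0 0
    rw [h, Polynomial.evalEval_zero] at h0
    simp [P] at h0
  obtain ⟨F, r, hr, hF, hF'⟩ := Polynomial.exists_vanishing_derivative_ne_zero p hp0
  obtain ⟨n, hn, hroot⟩ := Polynomial.exists_nat_eval_ne_zero_of_norm_eq (r * p.leadingCoeff)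
    (mul_ne_zero hr (Polynomial.leadingCoeff_ne_zero.2 hp0))
  simp only [Polynomial.eval_mul, mul_ne_zero_iff] at hroot
  obtain ⟨T, hT⟩ := Polynomial.exists_bound_evalEval_ne_zero p n fun x hx => (hroot x hx).2
  obtain ⟨D, G, hD, hG⟩ := MvPolynomial.exists_int_multiple H
  -- `m > T` moves the torus beyond the roots; `m > 0` makes `D * m` invertible.
  obtain ⟨m, hm⟩ := exists_nat_gt (max T 0)
  have hm0 : (m : ℚ) ≠ 0 := by
    have : (0 : ℝ) < m := (le_max_right _ _).trans_lt hm
    exact_mod_cast this.ne'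
  have hnQ : (n : ℚ) ≠ 0 := Nat.cast_ne_zero.2 hn
  have hDm : (D : ℚ) * m ≠ 0 := mul_ne_zero (Int.cast_ne_zero.2 hD) hm0
  let α : Transformation ℚ 2 :=
    ⟨![Units.mk0 c⁻¹ (inv_ne_zero hc), Units.mk0 (n : ℚ) hnQ, Units.mk0 ((D : ℚ) * m) hDm], w, M⟩
  let a : Fin 2 → ℚ := ![(n : ℚ), (D : ℚ) * m]
  have hact : α.act Q = MvPolynomial.aeval (fun i => algebraMap ℚ (LaurentPoly ℚ 2) (a i) *
      (X ℚ i : LaurentPoly ℚ 2)) P := by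
    have ha : ∀ i : Fin 2, ((α.v i.succ : ℚˣ) : ℚ) = a i := by
      intro i
      fin_cases i <;> rfl
    have h0 : ((α.v 0 : ℚˣ) : ℚ) * c = 1 := inv_mul_cancel₀ hc
    change scale α.v (shift w (changeVars M Q)) = _
    rw [hQP, scale_smul_aeval_X, h0, one_smul]
    simp only [ha]
  have hsubst : ∀ u : Fin 2 → ℂˣ,
      subst u (α.act Q) = p.evalEval ((n : ℂ) * u 0) ((D * m : ℂ) * u 1) := by
    intro u
    rw [hact, subst_aeval_algebraMap_mul_X, hp]
    congr 2
    ext i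
    fin_cases i <;> simp [a]
  have hx : ∀ u : Fin 2 → ℂˣ, ‖(u 0 : ℂ)‖ = 1 → ‖(n : ℂ) * u 0‖ = n := by
    intro u hu
    rw [norm_mul, hu, mul_one, Complex.norm_natCast]
  refine ⟨α, ?_, ?_, ?_⟩
  · let s : Fin 2 → LaurentPoly ℚ 2 := fun i => algebraMap ℚ (LaurentPoly ℚ 2) (a i) *
      (X ℚ i : LaurentPoly ℚ 2)
    let k : Fin 2 → ℤ := ![(n : ℤ), D * m]
    have hs : ∀ i, MvPolynomial.aeval (fun i => (X ℚ i : LaurentPoly ℚ 2))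
        (MvPolynomial.C (k i) * MvPolynomial.X i) = s i := by
      intro i
      have hk : ((k i : ℤ) : ℚ) = a i := by fin_cases i <;> simp [k, a]
      rw [map_mul, MvPolynomial.aeval_C, MvPolynomial.aeval_X, eq_intCast]
      simp only [s]
      rw [← hk, map_intCast]
    -- Since `G = D H`, the factor `D m` from rescaling the outer `y` gives `D m y H(n x, D m y) = y
    -- · m G(n x, D m y)`.
    refine ⟨MvPolynomial.C (m : ℤ) *
      MvPolynomial.aeval (fun i => MvPolynomial.C (k i) * MvPolynomial.X i) G, ?_⟩
    have hGs : MvPolynomial.aeval s G =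
        algebraMap ℚ (LaurentPoly ℚ 2) D * MvPolynomial.aeval s H := by
      rw [← MvPolynomial.aeval_C (σ := Fin 2) s (D : ℚ), ← map_mul, ← hG]
      exact (MvPolynomial.aeval_map_algebraMap ℚ s G).symm
    rw [hact, map_mul, MvPolynomial.comp_aeval_apply]
    simp only [hs]
    change MvPolynomial.aeval s P = 1 + _ * (_ * MvPolynomial.aeval s G)
    rw [hGs, map_add, map_one, map_mul, MvPolynomial.aeval_X]
    have hs1 : s 1 = algebraMap ℚ (LaurentPoly ℚ 2) D * algebraMap ℚ (LaurentPoly ℚ 2) m *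
        (X ℚ (1 : Fin 2) : LaurentPoly ℚ 2) := by
      rw [← map_mul]
      rfl
    rw [hs1, MvPolynomial.aeval_C]
    simp only [map_natCast]
    ring
  · rw [Set.eq_empty_iff_forall_notMem]
    rintro u ⟨hu, hu1⟩
    refine hT _ _ (hx u (hu1 0)) ?_ ((hsubst u).symm.trans hu)
    rw [norm_mul, hu1 1, mul_one, norm_mul, Complex.norm_natCast, Complex.norm_intCast]
    have hD1 : (1 : ℝ) ≤ |(D : ℝ)| := by exact_mod_cast Int.one_le_abs hD
    calc T ≤ m := (le_max_left _ _).trans hm.le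
      _ ≤ |(D : ℝ)| * m := le_mul_of_one_le_left m.cast_nonneg hD1
  · rw [Set.eq_empty_iff_forall_notMem]
    rintro u ⟨⟨hu, hu0, -⟩, -, hsing⟩
    -- `L` is `F` in the rescaled variables, a test function for the Jacobian criterion.
    obtain ⟨L, hL⟩ := exists_subst_eq_evalEval n (D * m) F
    have h := hsing L (fun t ht => (hL t).1.trans (hF _ _ ((hsubst t).symm.trans ht))) 1
    rw [(hL u).2] at h
    refine mul_ne_zero (by exact_mod_cast hDm) ?_ h
    exact hF' _ _ (hroot _ (hx u hu0)).1 ((hsubst u).symm.trans hu)
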